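/- Throughout, graphs are finite and simple, $A$ and $D$ are the adjacency and degree matrices, and a graph is planar if it can be drawn in the plane with distinct points as vertices and simple arcs as edges such that arcs meet each other and the vertices only at common end points. For a graph $G$ on $n$ nodes without isolated nodes let $P_G=D^{-1}A$. The random-walk tokenization of length $t$ assigns to each node $v$ the token of return probabilities $x_v=\big((P_G^1)_{vv},\dots,(P_G^{t})_{vv}\big)\in\mathbb{R}^{t}$; these tokens are the rows of the matrix $\mathcal{P}_t(G)\in\mathbb{R}^{n\times t}$. A transformer $T$ on $n$ tokens of dimension $t$ consists of a linear input projection to $\mathbb{R}^{n\times m}$, $L$ layers $Z=X+\mathrm{MHA}(X)$, $X'=Z+\mathrm{MLP}(Z)$ (multi-head softmax attention with $H$ heads of dimension $d_h=m/H$ and an output projection; a position-wise MLP of two linear layers with a nonlinearity), and a linear readout of the last layer to some $\mathbb{R}^k$. The numbers $L,m,H,k$, the MLP width, all weights, the nonlinearity, and an entrywise rounding map applied to all intermediate results (finite or infinite precision) are arbitrary. A switching set of a graph $G$ is a set $S$ of nodes that induces a regular subgraph and is such that every node outside $S$ has exactly $0$, $|S|/2$ or $|S|$ neighbours in $S$.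 The Godsil–McKay switched graph of $G$ with respect to $S$ is obtained by joining every node outside $S$ that has exactly $|S|/2$ neighbours in $S$ to the other nodes of $S$ instead, and leaving all other edges unchanged. **Theorem (planarity undecidability).** 1. There are a connected planar graph $G$ on $12$ nodes and a switching set $S$ of $G$ such that the switched graph $G'$ is connected and non-planar and $(P_G^m)_{vv}=(P_{G'}^m)_{vv}$ for all $m\ge 0$ and all nodes $v$. Consequently, for every $t:\mathbb{N}\to\mathbb{N}$, $\mathcal{P}_{t(12)}(G)=\mathcal{P}_{t(12)}(G')$, and every transformer $T$ on $12$ tokens of dimension $t(12)$ satisfies $T(\mathcal{P}_{t(12)}(G))=T(\mathcal{P}_{t(12)}(G'))$. 2. For every walk length $t:\mathbb{N}\to\mathbb{N}$, random-walk tokenization of length $t(n)$ cannot determine planarity, whatever the depth or width: for every family $(T_n)_n$ of transformers, $T_n$ on $n$ tokens of dimension $t(n)$, and all sets $Y_n$ of outputs, it is not the case that for all $n\ge1$ and all graphs $G$ on $n$ nodes without isolated nodes, $T_n(\mathcal{P}_{t(n)}(G))\in Y_n$ if and only if $G$ is planar. -/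

import Mathlib

noncomputable section

/-! ### Planarity -/

/-- A drawing of a graph in the plane without crossings: vertices are distinct points, every edge is
a simple arc joining the points of its two ends, no arc passes through a vertex in its interior, and
the arcs of two different edges do not meet in their interiors. -/
structure PlaneDrawing {V : Type*} (G : SimpleGraph V) where
  pos : V → ℝ × ℝ
  pos_injective : Function.Injective pos
  arc : ∀ {u v : V}, G.Adj u v → Path (pos u) (pos v)
  /-- The two orientations of an edge give the same arc, traversed in opposite directions. -/
  arc_symm : ∀ {u v : V} (h : G.Adj u v), arc h.symm = (arc h).symm
  arc_injective : ∀ {u v : V} (h : G.Adj u v), Function.Injective (arc h)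
  arc_avoids : ∀ {u v : V} (h : G.Adj u v) (s : unitInterval) (w : V),
    arc h s = pos w → s = 0 ∨ s = 1
  arc_disjoint : ∀ {u v x y : V} (h : G.Adj u v) (h' : G.Adj x y), s(u, v) ≠ s(x, y) →
    ∀ s s' : unitInterval, arc h s = arc h' s' → s = 0 ∨ s = 1

def IsPlanar {V : Type*} (G : SimpleGraph V) : Prop := Nonempty (PlaneDrawing G)

/-! ### Random-walk tokenization -/

/-- The transition matrix `D⁻¹ A` of the simple random walk. -/
def rwMatrix {n : ℕ} (G : SimpleGraph (Fin n)) : Matrix (Fin n) (Fin n) ℝ :=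
  open scoped Classical in
  Matrix.diagonal (fun v => ((G.degree v : ℝ))⁻¹) * G.adjMatrix ℝ

/-- The token of the node `v` is `((P ^ 1) v v, …, (P ^ t) v v)` with `P = D⁻¹ A`. -/
def rwTokens {n : ℕ} (t : ℕ) (G : SimpleGraph (Fin n)) : Matrix (Fin n) (Fin t) ℝ :=
  Matrix.of fun v i => (rwMatrix G ^ ((i : ℕ) + 1)) v v

/-! ### Godsil–McKay switching -/

/-- The number of neighbours of `v` in `S`. -/
def nbrsIn {n : ℕ} (G : SimpleGraph (Fin n)) (S : Finset (Fin n)) (v : Fin n) : ℕ :=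
  open scoped Classical in (S.filter (fun w => G.Adj v w)).card

/-- `S` induces a regular subgraph, and every node outside `S` is adjacent to none, exactly half,
or all of the nodes of `S`. -/
def IsSwitchingSet {n : ℕ} (G : SimpleGraph (Fin n)) (S : Finset (Fin n)) : Prop :=
  (∃ r : ℕ, ∀ v ∈ S, nbrsIn G S v = r) ∧
    ∀ v, v ∉ S → nbrsIn G S v = 0 ∨ 2 * nbrsIn G S v = S.card ∨ nbrsIn G S v = S.card

/-- The pair consisting of `s ∈ S` and a node `v ∉ S` adjacent to exactly half of `S`. -/
def IsSwitchedPair {n : ℕ} (G : SimpleGraph (Fin n)) (S : Finset (Fin n)) (s v : Fin n) : Prop :=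
  s ∈ S ∧ v ∉ S ∧ 2 * nbrsIn G S v = S.card

/-- The switched graph: each node outside `S` with exactly half of `S` as neighbours is joined to
the other half instead; all other adjacencies are kept. -/
def gmSwitch {n : ℕ} (G : SimpleGraph (Fin n)) (S : Finset (Fin n)) : SimpleGraph (Fin n) where
  Adj u v := (IsSwitchedPair G S u v ∨ IsSwitchedPair G S v u) ∧ ¬ G.Adj u v ∨
    ¬ (IsSwitchedPair G S u v ∨ IsSwitchedPair G S v u) ∧ G.Adj u v
  symm := ⟨fun u v h => by
    rw [G.adj_comm v u, or_comm (a := IsSwitchedPair G S v u)]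
    exact h⟩
  loopless := ⟨fun u h => by
    rcases h with ⟨⟨h1, h2, _⟩ | ⟨h1, h2, _⟩, _⟩ | ⟨_, h⟩
    · exact h2 h1
    · exact h2 h1
    · exact G.loopless.irrefl u h⟩

/-! ### Transformers -/

/-- Row-wise softmax. -/
def softmax {n : ℕ} (M : Matrix (Fin n) (Fin n) ℝ) : Matrix (Fin n) (Fin n) ℝ :=
  Matrix.of fun i j => Real.exp (M i j) / ∑ k, Real.exp (M i k)

/-- The parameters of one layer with `H` heads of dimension `dh` and MLP width `w`. The hidden
coordinates are indexed by `Fin H × Fin dh`, so that the hidden dimension is `H * dh` and the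
concatenation of the heads is indexed in the same way. -/
structure TransformerLayer (H dh w : ℕ) where
  WQ : Fin H → Matrix (Fin H × Fin dh) (Fin dh) ℝ
  WK : Fin H → Matrix (Fin H × Fin dh) (Fin dh) ℝ
  WV : Fin H → Matrix (Fin H × Fin dh) (Fin dh) ℝ
  WO : Matrix (Fin H × Fin dh) (Fin H × Fin dh) ℝ
  W₁ : Matrix (Fin H × Fin dh) (Fin w) ℝ
  b₁ : Fin w → ℝ
  /-- the nonlinearity of the MLP -/
  act : ℝ → ℝ
  W₂ : Matrix (Fin w) (Fin H × Fin dh) ℝ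
  b₂ : Fin H × Fin dh → ℝ

namespace TransformerLayer

variable {H dh w n : ℕ}

/-- One attention head. All intermediate matrices are rounded entrywise by `rnd`. -/
def head (rnd : ℝ → ℝ) (ℓ : TransformerLayer H dh w) (h : Fin H)
    (X : Matrix (Fin n) (Fin H × Fin dh) ℝ) : Matrix (Fin n) (Fin dh) ℝ :=
  let q := (X * ℓ.WQ h).map rnd
  let k := (X * ℓ.WK h).map rnd
  let v := (X * ℓ.WV h).map rnd
  let scores := ((Real.sqrt dh)⁻¹ • (q * k.transpose)).map rnd
  ((softmax scores).map rnd * v).map rnd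

/-- Multi-head attention: concatenation of the heads, then the output projection. -/
def mha (rnd : ℝ → ℝ) (ℓ : TransformerLayer H dh w) (X : Matrix (Fin n) (Fin H × Fin dh) ℝ) :
    Matrix (Fin n) (Fin H × Fin dh) ℝ :=
  ((Matrix.of fun i (c : Fin H × Fin dh) => ℓ.head rnd c.1 X i c.2) * ℓ.WO).map rnd

/-- Position-wise MLP: two linear layers with a nonlinearity in between. -/
def mlp (rnd : ℝ → ℝ) (ℓ : TransformerLayer H dh w) (X : Matrix (Fin n) (Fin H × Fin dh) ℝ) :
    Matrix (Fin n) (Fin H × Fin dh) ℝ :=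
  let hidden : Matrix (Fin n) (Fin w) ℝ :=
    (Matrix.of fun i j => ℓ.act (rnd ((X * ℓ.W₁) i j + ℓ.b₁ j))).map rnd
  Matrix.of fun i j => rnd ((hidden * ℓ.W₂) i j + ℓ.b₂ j)

/-- `Z = X + MHA(X)`, then `Z + MLP(Z)`. -/
def apply (rnd : ℝ → ℝ) (ℓ : TransformerLayer H dh w) (X : Matrix (Fin n) (Fin H × Fin dh) ℝ) :
    Matrix (Fin n) (Fin H × Fin dh) ℝ :=
  let Z := (X + ℓ.mha rnd X).map rnd
  (Z + ℓ.mlp rnd Z).map rnd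

end TransformerLayer

/-- A transformer on `n` tokens of dimension `d`. Its depth is the length of `layers`. The map `rnd`
rounds every intermediate number: the identity gives exact real arithmetic, and rounding to a set of
`2 ^ p` numbers gives `p`-bit precision. -/
structure Transformer (n d : ℕ) where
  heads : ℕ
  headDim : ℕ
  mlpDim : ℕ
  outDim : ℕ
  rnd : ℝ → ℝ
  Win : Matrix (Fin d) (Fin heads × Fin headDim) ℝ
  layers : List (TransformerLayer heads headDim mlpDim)
  readout : Matrix (Fin n) (Fin heads × Fin headDim) ℝ →ₗ[ℝ] (Fin outDim → ℝ)

/-- The output of the transformer on the token matrix `X`. -/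
def Transformer.eval {n d : ℕ} (T : Transformer n d) (X : Matrix (Fin n) (Fin d) ℝ) :
    Fin T.outDim → ℝ :=
  fun k => T.rnd (T.readout
    (T.layers.foldl (fun Y ℓ => ℓ.apply T.rnd Y) ((X.map T.rnd * T.Win).map T.rnd)) k)

end

/-! ### Continuous logarithms -/

/-! The planar graph is the cuboctahedron, and switching is done at four independent nodes that a
common automorphism of both graphs permutes cyclically. Both graphs are 4-regular, so `P = A / 4`.
Switching conjugates `A` by an involution `Q` that is the identity off the switching set, so closed
walk counts agree off it; equal traces and transitivity on the set give the rest
(`Matrix.pow_apply_self_eq_of_conj`). Equal tokens force equal outputs of any function of the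
tokens, in particular of any transformer.

Planarity is shown by a straight-line drawing. Non-planarity uses van Kampen's obstruction instead
of the Jordan curve theorem. For disjoint edges with arcs `γ`, `δ`, the map `γ s - δ t` never
vanishes, so it lifts through the covering `exp`, and its argument has total change zero around the
parameter square. Counting half-turns modulo two makes a combinatorial cocycle a coboundary
(`exists_cobounding`); evaluating it on the disjoint edge pairs of a subdivided `K₃,₃` gives a
contradiction (`not_isPlanar_of_obstruction`). -/

theorem exists_continuous_log {A : Type*} [TopologicalSpace A] [SimplyConnectedSpace A]
    [LocallyPathConnectedSpace A] (f : C(A, ℂ)) (hf : ∀ a, f a ≠ 0) :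
    ∃ g : C(A, ℂ), ∀ a, Complex.exp (g a) = f a := by
  obtain ⟨a₀⟩ : Nonempty A := inferInstance
  obtain ⟨g, ⟨-, hg⟩, -⟩ := Complex.isCoveringMap_exp.existsUnique_continuousMap_lifts
    (f := ⟨fun a => ⟨f a, hf a⟩, by fun_prop⟩) (a₀ := a₀) (e₀ := Complex.log (f a₀))
    (he := Subtype.ext (Complex.exp_log (hf a₀)))
  exact ⟨g, fun a => congrArg Subtype.val (congrFun hg a)⟩

/-- Two continuous logarithms of the same function on a connected space differ by a constant. -/
theorem sub_eq_sub_of_exp_eq_exp {A : Type*} [TopologicalSpace A] [PreconnectedSpace A]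
    {g h : A → ℂ} (hg : Continuous g) (hh : Continuous h)
    (H : ∀ a, Complex.exp (g a) = Complex.exp (h a)) (a b : A) : g b - g a = h b - h a := by
  have key : g = fun c => h c + (g a - h a) := by
    refine Complex.isCoveringMap_exp.eq_of_comp_eq hg (by fun_prop) ?_ a (by ring)
    funext c
    refine Subtype.ext ?_
    simp [Complex.exp_add, Complex.exp_sub, H]
  rw [congrFun key b]
  ring

/-- The total change of the logarithm of a nonvanishing path. -/
theorem exists_log_variation (f : ℝ → ℂ) (hf : Continuous f) (h0 : ∀ t, f t ≠ 0) :
    ∃ c : ℂ, Complex.exp c = f 1 / f 0 ∧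
      ∀ g : ℝ → ℂ, Continuous g → (∀ t, Complex.exp (g t) = f t) → g 1 - g 0 = c := by
  obtain ⟨g, hg⟩ := exists_continuous_log ⟨f, hf⟩ h0
  refine ⟨g 1 - g 0, by simp [Complex.exp_sub, hg], fun h hh H => ?_⟩
  exact sub_eq_sub_of_exp_eq_exp hh g.continuous (fun t => (H t).trans (hg t).symm) 0 1

/-- If two paths never meet, their difference has a continuous logarithm on the plane of
parameters. -/
theorem exists_continuous_log_sub (γ δ : ℝ → ℂ) (hγ : Continuous γ) (hδ : Continuous δ)
    (h0 : ∀ s t, γ s ≠ δ t) :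
    ∃ g : ℝ × ℝ → ℂ, Continuous g ∧ ∀ s t, Complex.exp (g (s, t)) = γ s - δ t := by
  obtain ⟨g, hg⟩ := exists_continuous_log (A := ℝ × ℝ)
    ⟨fun p => γ p.1 - δ p.2, by fun_prop⟩ (fun p => sub_ne_zero.2 (h0 p.1 p.2))
  exact ⟨g, g.continuous, fun s t => hg (s, t)⟩

/-! ### Turning numbers and the van Kampen cocycle -/

namespace PlaneDrawing

variable {V : Type*} {G : SimpleGraph V}

/-- The position of a vertex as a complex number. -/
noncomputable def point (D : PlaneDrawing G) (v : V) : ℂ := ⟨(D.pos v).1, (D.pos v).2⟩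

/-- The arc of an edge as a map to the complex numbers that is constant outside `[0, 1]`. -/
noncomputable def curve (D : PlaneDrawing G) {u v : V} (h : G.Adj u v) (t : ℝ) : ℂ :=
  ⟨((D.arc h).extend t).1, ((D.arc h).extend t).2⟩

variable {u v x y w : V} (D : PlaneDrawing G)

theorem point_injective : Function.Injective D.point := fun _ _ h =>
  D.pos_injective (Prod.ext (congrArg Complex.re h) (congrArg Complex.im h))

theorem continuous_curve (h : G.Adj u v) : Continuous (D.curve h) := by
  have : D.curve h = fun t => Complex.equivRealProdCLM.symm ((D.arc h).extend t) := by
    funext t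
    apply Complex.ext <;> simp [curve]
  rw [this]
  exact Complex.equivRealProdCLM.symm.continuous.comp (D.arc h).continuous_extend

@[simp] theorem curve_zero (h : G.Adj u v) : D.curve h 0 = D.point u := by
  simp [curve, point]

@[simp] theorem curve_one (h : G.Adj u v) : D.curve h 1 = D.point v := by
  simp [curve, point]

theorem curve_ne_point (h : G.Adj u v) (hu : w ≠ u) (hv : w ≠ v) (t : ℝ) :
    D.curve h t ≠ D.point w := by
  intro e
  have e' : D.arc h (Set.projIcc 0 1 zero_le_one t) = D.pos w :=
    Prod.ext (congrArg Complex.re e) (congrArg Complex.im e)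
  rcases D.arc_avoids h _ w e' with hs | hs <;> rw [hs] at e'
  · exact hu (D.pos_injective (by simpa using e'.symm))
  · exact hv (D.pos_injective (by simpa using e'.symm))

/-- A common point must be an end of `uv` by `arc_disjoint`, and then, being a vertex on the arc of
`xy`, an end of `xy` by `arc_avoids`. -/
theorem curve_ne_curve (h : G.Adj u v) (h' : G.Adj x y) (hux : u ≠ x) (huy : u ≠ y) (hvx : v ≠ x)
    (hvy : v ≠ y) (s t : ℝ) : D.curve h s ≠ D.curve h' t := by
  intro e
  have e' : D.arc h (Set.projIcc 0 1 zero_le_one s) = D.arc h' (Set.projIcc 0 1 zero_le_one t) :=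
    Prod.ext (congrArg Complex.re e) (congrArg Complex.im e)
  have hne : s(u, v) ≠ s(x, y) := by
    simp [hux, huy]
  rcases D.arc_disjoint h h' hne _ _ e' with hs | hs <;> rw [hs] at e'
  · rw [Path.source] at e'
    rcases D.arc_avoids h' _ u e'.symm with ht | ht <;> rw [ht] at e'
    · exact hux (D.pos_injective (by simpa using e'))
    · exact huy (D.pos_injective (by simpa using e'))
  · rw [Path.target] at e'
    rcases D.arc_avoids h' _ v e'.symm with ht | ht <;> rw [ht] at e'
    · exact hvx (D.pos_injective (by simpa using e'))
    · exact hvy (D.pos_injective (by simpa using e'))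

/-- The arc of an edge turns about every vertex off the edge by a well-defined amount, and the
amounts of two edges without common ends satisfy a linear relation. -/
theorem exists_turning (D : PlaneDrawing G) : ∃ L : V → V → V → ℂ,
    (∀ u v w, G.Adj u v → w ≠ u → w ≠ v →
      Complex.exp (L u v w) = (D.point v - D.point w) / (D.point u - D.point w)) ∧
    ∀ u v x y, G.Adj u v → G.Adj x y → u ≠ x → u ≠ y → v ≠ x → v ≠ y →
      L u v x + L x y v = L u v y + L x y u := by
  have H : ∀ u v w, ∃ c : ℂ, ∀ h : G.Adj u v, w ≠ u → w ≠ v →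
      Complex.exp c = (D.point v - D.point w) / (D.point u - D.point w) ∧
      ∀ g : ℝ → ℂ, Continuous g →
        (∀ t, Complex.exp (g t) = D.curve h t - D.point w) → g 1 - g 0 = c := by
    intro u v w
    by_cases h : G.Adj u v ∧ w ≠ u ∧ w ≠ v
    · obtain ⟨h, hu, hv⟩ := h
      obtain ⟨c, hc, hc'⟩ := exists_log_variation (fun t => D.curve h t - D.point w)
        ((D.continuous_curve h).sub continuous_const)
        (fun t => sub_ne_zero.2 (D.curve_ne_point h hu hv t))
      exact ⟨c, fun _ _ _ => ⟨by simpa using hc, hc'⟩⟩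
    · exact ⟨0, fun h1 h2 h3 => (h ⟨h1, h2, h3⟩).elim⟩
  choose L hL using H
  refine ⟨L, fun u v w h hu hv => (hL u v w h hu hv).1, fun u v x y h h' hux huy hvx hvy => ?_⟩
  -- One logarithm on the whole parameter plane; its changes along the four sides of the unit square
  -- are the four turnings, so the relation telescopes.
  obtain ⟨g, hg, hexp⟩ := exists_continuous_log_sub _ _ (D.continuous_curve h)
    (D.continuous_curve h') (D.curve_ne_curve h h' hux huy hvx hvy)
  have e1 := (hL u v x h hux.symm hvx.symm).2 (fun t => g (t, 0)) (by fun_prop)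
    (fun t => by rw [hexp, curve_zero])
  have e2 := (hL u v y h huy.symm hvy.symm).2 (fun t => g (t, 1)) (by fun_prop)
    (fun t => by rw [hexp, curve_one])
  -- Here the moving point is on `xy`, so the difference has the opposite sign; adding `πi` corrects
  -- the logarithm and does not affect its change.
  have e3 := (hL x y u h' hux huy).2 (fun t => g (0, t) + Real.pi * Complex.I) (by fun_prop)
    (fun t => by rw [Complex.exp_add, hexp, curve_zero, Complex.exp_pi_mul_I]; ring)
  have e4 := (hL x y v h' hvx hvy).2 (fun t => g (1, t) + Real.pi * Complex.I) (by fun_prop)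
    (fun t => by rw [Complex.exp_add, hexp, curve_one, Complex.exp_pi_mul_I]; ring)
  rw [← e1, ← e2, ← e3, ← e4]
  ring

/-- The van Kampen cocycle of a planar graph is a coboundary modulo two. -/
theorem exists_cobounding [LinearOrder V] (D : PlaneDrawing G) : ∃ n : V × V × V → ZMod 2,
    ∀ u v x y, G.Adj u v → G.Adj x y → u ≠ x → u ≠ y → v ≠ x → v ≠ y →
      n (u, v, x) + n (u, v, y) + n (x, y, u) + n (x, y, v) =
        (if x < u then 1 else 0) + (if x < v then 1 else 0) +
          (if y < u then 1 else 0) + (if y < v then 1 else 0) := by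
  obtain ⟨L, hL, hrel⟩ := D.exists_turning
  -- Fixed logarithms of the differences of vertices. Exchanging the two vertices adds `πi` or
  -- `-πi`, with the sign given by the order; this is the source of the right-hand side.
  obtain ⟨a, ha, hsymm⟩ : ∃ a : V → V → ℂ,
      (∀ u x, u ≠ x → Complex.exp (a u x) = D.point u - D.point x) ∧
      ∀ u x, u ≠ x → a x u = a u x +
        (1 - 2 * ((if x < u then 1 else 0 : ℤ) : ℂ)) * (Real.pi * Complex.I) := by
    refine ⟨fun u x => if x < u then Complex.log (D.point x - D.point u) + Real.pi * Complex.I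
      else Complex.log (D.point u - D.point x), fun u x hux => ?_, fun u x hux => ?_⟩
    · have h1 : D.point u - D.point x ≠ 0 := sub_ne_zero.2 (D.point_injective.ne hux)
      have h2 : D.point x - D.point u ≠ 0 := sub_ne_zero.2 (D.point_injective.ne hux.symm)
      dsimp only
      split_ifs
      · rw [Complex.exp_add, Complex.exp_log h2, Complex.exp_pi_mul_I]; ring
      · rw [Complex.exp_log h1]
    · dsimp only
      rcases lt_or_gt_of_ne hux with h | h
      · rw [if_pos h, if_neg h.not_gt, if_neg h.not_gt]; push_cast; ring
      · rw [if_pos h, if_neg h.not_gt, if_pos h]; push_cast; ring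
  -- The integer `k` is the number of full turns by which the arc differs from the fixed logarithms;
  -- modulo two it is the required cochain.
  have H : ∀ u v w, ∃ k : ℤ, G.Adj u v → w ≠ u → w ≠ v →
      L u v w = a v w - a u w + k * (2 * Real.pi * Complex.I) := by
    intro u v w
    by_cases h : G.Adj u v ∧ w ≠ u ∧ w ≠ v
    · obtain ⟨h, hu, hv⟩ := h
      have : Complex.exp (L u v w) = Complex.exp (a v w - a u w) := by
        rw [hL u v w h hu hv, Complex.exp_sub, ha v w hv.symm, ha u w hu.symm]
      obtain ⟨k, hk⟩ := Complex.exp_eq_exp_iff_exists_int.1 this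
      exact ⟨k, fun _ _ _ => hk⟩
    · exact ⟨0, fun h1 h2 h3 => (h ⟨h1, h2, h3⟩).elim⟩
  choose k hk using H
  refine ⟨fun p => (k p.1 p.2.1 p.2.2 : ZMod 2), fun u v x y h h' hux huy hvx hvy => ?_⟩
  have e := hrel u v x y h h' hux huy hvx hvy
  rw [hk u v x h hux.symm hvx.symm, hk u v y h huy.symm hvy.symm, hk x y u h' hux huy,
    hk x y v h' hvx hvy, hsymm u x hux, hsymm v x hvx, hsymm u y huy, hsymm v y hvy] at e
  have e' : ((k u v x + k x y v - k u v y - k x y u : ℤ) : ℂ) =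
      (((if x < u then 1 else 0) - (if x < v then 1 else 0) - (if y < u then 1 else 0) +
        (if y < v then 1 else 0) : ℤ) : ℂ) := by
    have hpi : (2 * Real.pi * Complex.I : ℂ) ≠ 0 := Complex.two_pi_I_ne_zero
    apply mul_right_cancel₀ hpi
    push_cast at e ⊢
    linear_combination e
  have e'' := congrArg (Int.cast : ℤ → ZMod 2) (Int.cast_injective e')
  push_cast at e''
  simp only [CharTwo.sub_eq_add] at e''
  linear_combination e''

end PlaneDrawing

/-- A sum over a list in which every entry occurs an even number of times vanishes modulo two. -/
theorem List.sum_map_eq_zero_of_even_count {α : Type*} [DecidableEq α] (l : List α)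
    (f : α → ZMod 2) (hl : ∀ a ∈ l, Even (l.count a)) : (l.map f).sum = 0 := by
  rw [Finset.sum_list_map_count]
  refine Finset.sum_eq_zero fun a ha => ?_
  obtain ⟨k, hk⟩ := hl a (List.mem_toFinset.1 ha)
  rw [hk, add_smul, CharTwo.add_self_eq_zero]

/-- The incidences between an edge of the pair `uv`, `xy` and an end of the other edge. -/
def pairIncidences {V : Type*} : V × V × V × V → List (V × V × V)
  | (u, v, x, y) => [(u, v, x), (u, v, y), (x, y, u), (x, y, v)]

/-- The number, modulo two, of the ends of `uv` that exceed the ends of `xy`. -/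
def pairParity {V : Type*} [LinearOrder V] : V × V × V × V → ZMod 2
  | (u, v, x, y) => (if x < u then 1 else 0) + (if x < v then 1 else 0) +
      (if y < u then 1 else 0) + (if y < v then 1 else 0)

/-- A van Kampen obstruction to planarity: a collection of pairs of disjoint edges that is a cycle
modulo two and on which the van Kampen cocycle does not vanish. -/
theorem not_isPlanar_of_obstruction {V : Type*} [LinearOrder V] {G : SimpleGraph V}
    (l : List (V × V × V × V))
    (hl : ∀ p ∈ l, G.Adj p.1 p.2.1 ∧ G.Adj p.2.2.1 p.2.2.2 ∧ p.1 ≠ p.2.2.1 ∧ p.1 ≠ p.2.2.2 ∧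
      p.2.1 ≠ p.2.2.1 ∧ p.2.1 ≠ p.2.2.2)
    (hcycle : ∀ a ∈ l.flatMap pairIncidences, Even ((l.flatMap pairIncidences).count a))
    (hodd : (l.map pairParity).sum ≠ 0) : ¬ IsPlanar G := by
  rintro ⟨D⟩
  obtain ⟨n, hn⟩ := D.exists_cobounding
  apply hodd
  -- The zero is rewritten as the sum of `n` over all incidences, which is then compared with the
  -- parities pair by pair.
  rw [← List.sum_map_eq_zero_of_even_count _ n fun a ha => by convert hcycle a ha, List.map_flatMap,
    List.flatMap_def, List.sum_flatten, List.map_map]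
  congr 1
  refine List.map_congr_left fun p hp => ?_
  obtain ⟨h1, h2, h3, h4, h5, h6⟩ := hl p hp
  have := hn _ _ _ _ h1 h2 h3 h4 h5 h6
  simp only [Function.comp_apply, pairIncidences, pairParity, List.map_cons, List.map_nil,
    List.sum_cons, List.sum_nil]
  rw [← this]
  ring

/-! ### Straight-line drawings with integer coordinates -/

/-- Twice the signed area of the triangle `p q r`. -/
def signedArea {R : Type*} [CommRing R] (p q r : R × R) : R :=
  (q.1 - p.1) * (r.2 - p.2) - (q.2 - p.2) * (r.1 - p.1)

theorem signedArea_self_left {R : Type*} [CommRing R] (p q : R × R) : signedArea p q p = 0 := by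
  simp only [signedArea]; ring

theorem signedArea_self_right {R : Type*} [CommRing R] (p q : R × R) : signedArea p q q = 0 := by
  simp only [signedArea]; ring

theorem signedArea_lineMap (p q x y : ℝ × ℝ) (s : ℝ) :
    signedArea p q (AffineMap.lineMap x y s) =
      (1 - s) * signedArea p q x + s * signedArea p q y := by
  simp only [signedArea, AffineMap.lineMap_apply, vsub_eq_sub, vadd_eq_add, Prod.fst_add,
    Prod.snd_add, Prod.smul_fst, Prod.smul_snd, Prod.fst_sub, Prod.snd_sub, smul_eq_mul]
  ring

/-- The real point with given integer coordinates. -/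
def latticePoint (p : ℤ × ℤ) : ℝ × ℝ := (p.1, p.2)

theorem latticePoint_injective : Function.Injective latticePoint := fun _ _ h =>
  Prod.ext (Int.cast_injective (congrArg Prod.fst h)) (Int.cast_injective (congrArg Prod.snd h))

theorem signedArea_latticePoint (p q r : ℤ × ℤ) :
    signedArea (latticePoint p) (latticePoint q) (latticePoint r) = (signedArea p q r : ℤ) := by
  simp [signedArea, latticePoint]

/-- A segment whose ends lie strictly on the same side of a line does not meet that line. -/
theorem signedArea_lineMap_ne_zero {p q x y : ℝ × ℝ}
    (h : 0 < signedArea p q x * signedArea p q y) {s : ℝ} (h0 : 0 ≤ s) (h1 : s ≤ 1) :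
    signedArea p q (AffineMap.lineMap x y s) ≠ 0 := by
  rw [signedArea_lineMap]
  intro e
  rcases mul_pos_iff.1 h with ⟨hx, hy⟩ | ⟨hx, hy⟩
  · nlinarith [mul_nonneg (sub_nonneg.2 h1) hx.le, mul_nonneg h0 hy.le]
  · nlinarith [mul_nonneg (sub_nonneg.2 h1) (neg_pos.2 hx).le, mul_nonneg h0 (neg_pos.2 hy).le]

/-- A graph is planar if its vertices have integer positions such that no vertex lies on the line of
an edge unless it is an end of it, and of two edges without common end at least one lies strictly on
one side of the line of the other. -/
theorem isPlanar_of_integer_drawing {V : Type*} {G : SimpleGraph V} (p : V → ℤ × ℤ)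
    (hp : Function.Injective p)
    (hline : ∀ u v w, G.Adj u v → w ≠ u → w ≠ v → signedArea (p u) (p v) (p w) ≠ 0)
    (hcross : ∀ u v x y, G.Adj u v → G.Adj x y → u ≠ x → u ≠ y → v ≠ x → v ≠ y →
      0 < signedArea (p u) (p v) (p x) * signedArea (p u) (p v) (p y) ∨
      0 < signedArea (p x) (p y) (p u) * signedArea (p x) (p y) (p v)) : IsPlanar G := by
  let P : V → ℝ × ℝ := fun v => latticePoint (p v)
  have hP : Function.Injective P := latticePoint_injective.comp hp
  have hlineR : ∀ u v w, G.Adj u v → w ≠ u → w ≠ v → signedArea (P u) (P v) (P w) ≠ 0 := by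
    intro u v w h hu hv
    simp only [P, signedArea_latticePoint]
    exact_mod_cast hline u v w h hu hv
  have hcrossR : ∀ u v x y, G.Adj u v → G.Adj x y → u ≠ x → u ≠ y → v ≠ x → v ≠ y →
      0 < signedArea (P u) (P v) (P x) * signedArea (P u) (P v) (P y) ∨
      0 < signedArea (P x) (P y) (P u) * signedArea (P x) (P y) (P v) := by
    intro u v x y h h' h1 h2 h3 h4
    simp only [P, signedArea_latticePoint]
    exact_mod_cast hcross u v x y h h' h1 h2 h3 h4
  have hmem : ∀ u v (s : ℝ), signedArea (P u) (P v) (AffineMap.lineMap (P u) (P v) s) = 0 := by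
    intro u v s
    rw [signedArea_lineMap, signedArea_self_left, signedArea_self_right]
    ring
  -- Edges with a common end lie on different lines, which meet only at that end; the remaining
  -- cases reduce to this one by reversing segments.
  have hshare : ∀ u v w (s t : ℝ), G.Adj u v → w ≠ u → w ≠ v →
      (AffineMap.lineMap (P u) (P v) s : ℝ × ℝ) = AffineMap.lineMap (P u) (P w) t → s = 0 := by
    intro u v w s t h hu hv e
    have h1 := hmem u v s
    rw [e, signedArea_lineMap, signedArea_self_left, mul_zero, zero_add] at h1
    have ht : t = 0 := (mul_eq_zero.1 h1).resolve_right (hlineR u v w h hu hv)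
    rw [ht, AffineMap.lineMap_apply_zero, AffineMap.lineMap_eq_left_iff] at e
    exact e.resolve_left (hP.ne h.ne)
  have hinj : ∀ u v, G.Adj u v → Function.Injective (AffineMap.lineMap (k := ℝ) (P u) (P v)) :=
    fun u v h => AffineMap.lineMap_injective ℝ (hP.ne h.ne)
  have hrev : ∀ u v (s : ℝ), (AffineMap.lineMap (P u) (P v) s : ℝ × ℝ) =
      AffineMap.lineMap (P v) (P u) (1 - s) := fun u v s =>
    (AffineMap.lineMap_apply_one_sub _ _ _).symm
  refine ⟨⟨P, hP, fun {u v} _ => ⟨⟨fun s => AffineMap.lineMap (P u) (P v) (s : ℝ), by fun_prop⟩,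
    by simp, by simp⟩, ?_, ?_, ?_, ?_⟩⟩
  · intro u v h
    ext1
    funext s
    simp only [Path.coe_mk_mk, Path.symm_apply]
    exact hrev v u s
  · intro u v h s t e
    exact Subtype.ext (hinj u v h e)
  · intro u v h s w e
    have e : (AffineMap.lineMap (P u) (P v) (s : ℝ) : ℝ × ℝ) = P w := e
    by_cases hu : w = u
    · subst hu
      rw [AffineMap.lineMap_eq_left_iff] at e
      exact Or.inl (Subtype.ext (e.resolve_left (hP.ne h.ne)))
    by_cases hv : w = v
    · subst hv
      rw [AffineMap.lineMap_eq_right_iff] at e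
      exact Or.inr (Subtype.ext (e.resolve_left (hP.ne h.ne)))
    have := hmem u v s
    rw [e] at this
    exact (hlineR u v w h hu hv this).elim
  · intro u v x y h h' hne s t e
    have e : (AffineMap.lineMap (P u) (P v) (s : ℝ) : ℝ × ℝ) =
      AffineMap.lineMap (P x) (P y) (t : ℝ) := e
    by_cases hux : u = x
    · subst hux
      have hyv : y ≠ v := fun hyv => hne (by rw [hyv])
      exact Or.inl (Subtype.ext (hshare u v y s t h h'.ne.symm hyv e))
    by_cases huy : u = y
    · subst huy
      have hxv : x ≠ v := fun hxv => hne (by rw [hxv, Sym2.eq_swap])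
      rw [hrev x u] at e
      exact Or.inl (Subtype.ext (hshare u v x s _ h h'.ne hxv e))
    rw [hrev u v] at e
    by_cases hvx : v = x
    · subst hvx
      have := hshare v u y _ t h.symm h'.ne.symm (Ne.symm huy) e
      exact Or.inr (Subtype.ext (by rw [Set.Icc.coe_one]; linarith))
    by_cases hvy : v = y
    · subst hvy
      rw [hrev x v] at e
      have := hshare v u x _ _ h.symm h'.ne (Ne.symm hux) e
      exact Or.inr (Subtype.ext (by rw [Set.Icc.coe_one]; linarith))
    rw [← hrev u v] at e
    rcases hcrossR u v x y h h' hux huy hvx hvy with hc | hc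
    · exact (signedArea_lineMap_ne_zero hc t.2.1 t.2.2 (e ▸ hmem u v s)).elim
    · exact (signedArea_lineMap_ne_zero hc s.2.1 s.2.2 (e ▸ hmem x y t)).elim

/-! ### Return probabilities and switching -/

theorem Matrix.trace_eq_sum_add_sum_compl {V : Type*} [Fintype V] [DecidableEq V]
    (M : Matrix V V ℝ) (S : Finset V) :
    M.trace = ∑ v ∈ S, M v v + ∑ v ∈ Sᶜ, M v v :=
  (Finset.sum_add_sum_compl S fun v => M v v).symm

theorem Matrix.pow_apply_perm {V : Type*} [Fintype V] [DecidableEq V] {A : Matrix V V ℝ}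
    (σ : Equiv.Perm V) (hA : ∀ u v, A (σ u) (σ v) = A u v) (m : ℕ) (u v : V) :
    (A ^ m) (σ u) (σ v) = (A ^ m) u v := by
  induction m generalizing u v with
  | zero => simp [Matrix.one_apply]
  | succ m ih =>
    rw [pow_succ, Matrix.mul_apply, Matrix.mul_apply, ← Equiv.sum_comp σ]
    exact Finset.sum_congr rfl fun w _ => by rw [ih, hA]

theorem Matrix.pow_apply_self_eq_of_orbit {V : Type*} [Fintype V] [DecidableEq V]
    {A : Matrix V V ℝ} (σ : Equiv.Perm V) (hA : ∀ u v, A (σ u) (σ v) = A u v) (m k : ℕ) (v : V) :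
    (A ^ m) ((σ ^ k) v) ((σ ^ k) v) = (A ^ m) v v := by
  induction k with
  | zero => simp
  | succ k ih => rw [pow_succ', Equiv.Perm.mul_apply, Matrix.pow_apply_perm σ hA, ih]

/-- If two matrices are conjugate under an involution that only affects the indices in `S`, and both
are invariant under a permutation that is transitive on `S`, then all of their powers have the same
diagonal. -/
theorem Matrix.pow_apply_self_eq_of_conj {V : Type*} [Fintype V] [DecidableEq V]
    {A B Q : Matrix V V ℝ} (S : Finset V) (σ : Equiv.Perm V) (hQ : Q * Q = 1)
    (hAB : B * Q = Q * A) (hrow : ∀ v, v ∉ S → ∀ w, Q v w = if v = w then 1 else 0)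
    (hcol : ∀ v, v ∉ S → ∀ w, Q w v = if w = v then 1 else 0)
    (hA : ∀ u v, A (σ u) (σ v) = A u v) (hB : ∀ u v, B (σ u) (σ v) = B u v)
    (hσ : ∀ u ∈ S, ∀ v ∈ S, ∃ k : ℕ, (σ ^ k) u = v) (m : ℕ) (v : V) :
    (A ^ m) v v = (B ^ m) v v := by
  have hpow : B ^ m * Q = Q * A ^ m := by
    have h : SemiconjBy Q A B := hAB.symm
    exact (h.pow_right m).eq.symm
  have hconj : B ^ m = Q * A ^ m * Q := by
    rw [← hpow, mul_assoc, hQ, mul_one]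
  -- Row and column `w` of `Q` are those of the identity, so conjugation by `Q` keeps the entry at
  -- `(w, w)`.
  have houtside : ∀ w, w ∉ S → (A ^ m) w w = (B ^ m) w w := by
    intro w hw
    rw [hconj, Matrix.mul_apply]
    simp only [hcol w hw, mul_ite, mul_one, mul_zero, Finset.sum_ite_eq', Finset.mem_univ, if_true]
    rw [Matrix.mul_apply]
    simp only [hrow w hw, ite_mul, one_mul, zero_mul, Finset.sum_ite_eq, Finset.mem_univ, if_true]
  by_cases hv : v ∈ S
  -- Conjugate powers have equal traces, so the diagonal sums over `S` agree; each diagonal is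
  -- constant on `S` by transitivity.
  · have htr : (B ^ m).trace = (A ^ m).trace := by
      rw [hconj, Matrix.trace_mul_comm, ← mul_assoc, hQ, one_mul]
    have hconst : ∀ M : Matrix V V ℝ, (∀ u v, M (σ u) (σ v) = M u v) →
        ∑ w ∈ S, (M ^ m) w w = S.card * (M ^ m) v v := by
      intro M hM
      rw [← nsmul_eq_mul, ← Finset.sum_const]
      refine Finset.sum_congr rfl fun w hw => ?_
      obtain ⟨k, rfl⟩ := hσ v hv w hw
      exact Matrix.pow_apply_self_eq_of_orbit σ hM m k v
    rw [Matrix.trace_eq_sum_add_sum_compl _ S, Matrix.trace_eq_sum_add_sum_compl _ S, hconst A hA,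
      hconst B hB, Finset.sum_congr rfl fun w hw => houtside w (Finset.mem_compl.1 hw)] at htr
    have hcard : (S.card : ℝ) ≠ 0 := by
      exact_mod_cast (Finset.card_pos.2 ⟨v, hv⟩).ne'
    exact mul_left_cancel₀ hcard (add_right_cancel htr).symm
  · exact houtside v hv

theorem nbrsIn_eq_card_filter {n : ℕ} (G : SimpleGraph (Fin n)) [DecidableRel G.Adj]
    (S : Finset (Fin n)) (v : Fin n) : nbrsIn G S v = (S.filter (G.Adj v)).card := by
  unfold nbrsIn
  congr!

theorem rwMatrix_of_regular {n d : ℕ} (G : SimpleGraph (Fin n)) [DecidableRel G.Adj]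
    (h : ∀ v, G.degree v = d) : rwMatrix G = (d : ℝ)⁻¹ • G.adjMatrix ℝ := by
  ext u v
  have hu : (d : ℝ) = (G.degree u : ℝ) := by rw [h u]
  rw [Matrix.smul_apply, hu, smul_eq_mul, rwMatrix, Matrix.diagonal_mul]
  congr!

/-- A graph is connected if iterating a map along edges leads from every vertex to a fixed one. -/
theorem SimpleGraph.connected_of_iterate {V : Type*} {G : SimpleGraph V} (f : V → V) (r : V) (k : ℕ)
    (hf : ∀ v, v = f v ∨ G.Adj v (f v)) (hr : ∀ v, f^[k] v = r) : G.Connected := by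
  have hreach : ∀ (j : ℕ) (v : V), G.Reachable v (f^[j] v) := by
    intro j
    induction j with
    | zero => exact fun v => SimpleGraph.Reachable.refl v
    | succ j ih =>
      intro v
      rw [Function.iterate_succ_apply]
      refine SimpleGraph.Reachable.trans ?_ (ih (f v))
      rcases hf v with h | h
      · rw [← h]
      · exact h.reachable
  have : Nonempty V := ⟨r⟩
  refine ⟨fun u v => ?_⟩
  have hu := hreach k u
  have hv := hreach k v
  rw [hr] at hu hv
  exact hu.trans hv.symm

/-! ### The pair of graphs -/

/-- The neighbours of the nodes of a planar graph that is regular of degree four. -/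
def planarNeighbors : Fin 12 → List (Fin 12) :=
  ![[4, 6, 8, 11], [5, 7, 8, 9], [4, 6, 9, 10], [5, 7, 10, 11], [0, 2, 10, 11], [1, 3, 8, 11],
    [0, 2, 8, 9], [1, 3, 9, 10], [0, 1, 5, 6], [1, 2, 6, 7], [2, 3, 4, 7], [0, 3, 4, 5]]

/-- The neighbours after switching with respect to the nodes `0`, `1`, `2`, `3`. -/
def switchedNeighbors : Fin 12 → List (Fin 12) :=
  ![[5, 7, 9, 10], [4, 6, 10, 11], [5, 7, 8, 11], [4, 6, 8, 9], [1, 3, 10, 11], [0, 2, 8, 11],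
    [1, 3, 8, 9], [0, 2, 9, 10], [2, 3, 5, 6], [0, 3, 6, 7], [0, 1, 4, 7], [1, 2, 4, 5]]

def planarGraph : SimpleGraph (Fin 12) where
  Adj u v := v ∈ planarNeighbors u
  symm := ⟨by decide⟩
  loopless := ⟨by decide⟩

def switchedGraph : SimpleGraph (Fin 12) where
  Adj u v := v ∈ switchedNeighbors u
  symm := ⟨by decide⟩
  loopless := ⟨by decide⟩

instance : DecidableRel planarGraph.Adj := fun u v =>
  inferInstanceAs (Decidable (v ∈ planarNeighbors u))

instance : DecidableRel switchedGraph.Adj := fun u v =>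
  inferInstanceAs (Decidable (v ∈ switchedNeighbors u))

def switchingNodes : Finset (Fin 12) := {0, 1, 2, 3}

theorem isSwitchingSet_switchingNodes : IsSwitchingSet planarGraph switchingNodes := by
  refine ⟨⟨0, ?_⟩, ?_⟩
  · simp only [nbrsIn_eq_card_filter]
    decide
  · simp only [nbrsIn_eq_card_filter]
    decide

theorem gmSwitch_planarGraph : gmSwitch planarGraph switchingNodes = switchedGraph := by
  ext u v
  simp only [gmSwitch, IsSwitchedPair, nbrsIn_eq_card_filter]
  revert u v
  decide

theorem planarGraph_connected : planarGraph.Connected :=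
  -- Parent pointers of a spanning tree of depth three with root `0`, the root pointing to itself.
  SimpleGraph.connected_of_iterate ![0, 8, 4, 11, 0, 8, 0, 9, 0, 6, 4, 0] 0 3
    (by decide) (by decide)

theorem switchedGraph_connected : switchedGraph.Connected :=
  SimpleGraph.connected_of_iterate ![0, 10, 5, 9, 10, 0, 9, 0, 5, 0, 0, 5] 0 2
    (by decide) (by decide)

theorem isPlanar_planarGraph : IsPlanar planarGraph :=
  isPlanar_of_integer_drawing
    -- Three nested squares `0 4 2 6`, `8 11 10 9` and `1 5 3 7`, each invariant under the quarter
    -- turn about the origin. The outer and inner squares are 4-cycles; each node of the middle one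
    -- is joined to two nodes of either.
    ![(7, 2), (0, -1), (-7, -2), (0, 1), (-2, 7), (1, 0), (2, -7), (-1, 0), (3, -1), (-1, -3),
      (-3, 1), (1, 3)]
    (by decide) (by decide) (by decide +kernel)

/-- The pairs of disjoint edges of a subdivision of `K₃,₃` that subdivide disjoint edges
of `K₃,₃`. -/
def disjointEdgePairs : List (Fin 12 × Fin 12 × Fin 12 × Fin 12) :=
  [(0, 5, 3, 4), (0, 5, 4, 10), (5, 8, 3, 4), (5, 8, 4, 10), (0, 5, 3, 9), (5, 8, 3, 9),
    (0, 5, 1, 6), (0, 5, 1, 10), (5, 8, 1, 6), (5, 8, 1, 10), (0, 5, 6, 9), (5, 8, 6, 9),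
    (0, 9, 3, 4), (0, 9, 4, 10), (0, 9, 3, 8), (0, 9, 1, 6), (0, 9, 1, 10), (0, 9, 6, 8),
    (0, 10, 3, 8), (0, 10, 3, 9), (0, 10, 6, 8), (0, 10, 6, 9), (3, 4, 6, 8), (4, 10, 6, 8),
    (3, 4, 6, 9), (4, 10, 6, 9), (3, 8, 1, 6), (3, 8, 1, 10), (3, 8, 6, 9), (3, 9, 1, 6),
    (3, 9, 1, 10), (3, 9, 6, 8)]

theorem not_isPlanar_switchedGraph : ¬ IsPlanar switchedGraph :=
  -- The branch nodes are `0, 3, 6` and `8, 9, 10`; the nodes `5, 4, 1` subdivide `0 8`, `3 10`, `6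
  -- 10`. Every edge is listed in one orientation only, because incidences are compared as ordered
  -- triples.
  not_isPlanar_of_obstruction disjointEdgePairs (List.all_iff_forall_prop.1 (by decide +kernel))
    (List.all_iff_forall_prop.1 (by decide +kernel)) (by decide +kernel)

/-- Twice the Godsil–McKay involution. -/
def switchingMatrix : Matrix (Fin 12) (Fin 12) ℤ :=
  Matrix.of fun u v => (if u ∈ switchingNodes ∧ v ∈ switchingNodes then 1 else 0) +
    (if u = v then if u ∈ switchingNodes then -2 else 2 else 0)

theorem switchingMatrix_mul_self : switchingMatrix * switchingMatrix = 4 := by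
  decide +kernel

/-- On the switching set the involution is `J / 2 - 1`, with `J` the all-ones matrix. It sends the
indicator of two of the four nodes to that of the other two, and every outside node has exactly two
neighbours in the set. -/
theorem adjMatrix_mul_switchingMatrix :
    switchedGraph.adjMatrix ℤ * switchingMatrix = switchingMatrix * planarGraph.adjMatrix ℤ := by
  decide +kernel

/-- A common automorphism of the two graphs. -/
def nodeRotation : Equiv.Perm (Fin 12) where
  toFun := ![1, 2, 3, 0, 5, 6, 7, 4, 9, 10, 11, 8]
  invFun := ![3, 0, 1, 2, 7, 4, 5, 6, 11, 8, 9, 10]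
  left_inv := by decide
  right_inv := by decide

theorem SimpleGraph.adjMatrix_map_intCast {V : Type*} (G : SimpleGraph V) [DecidableRel G.Adj] :
    (G.adjMatrix ℤ).map (Int.castRingHom ℝ) = G.adjMatrix ℝ := by
  ext u v
  simp [SimpleGraph.adjMatrix_apply]

theorem rwMatrix_pow_apply_self (m : ℕ) (v : Fin 12) :
    (rwMatrix planarGraph ^ m) v v = (rwMatrix switchedGraph ^ m) v v := by
  rw [rwMatrix_of_regular (d := 4) planarGraph (by decide),
    rwMatrix_of_regular (d := 4) switchedGraph (by decide)]
  let f : ℤ →+* ℝ := Int.castRingHom ℝ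
  have hrotP : ∀ u v, planarGraph.Adj (nodeRotation u) (nodeRotation v) ↔ planarGraph.Adj u v := by decide
  have hrotS : ∀ u v, switchedGraph.Adj (nodeRotation u) (nodeRotation v) ↔ switchedGraph.Adj u v := by
    decide
  have hrow : ∀ v w, v ∉ switchingNodes → switchingMatrix v w = if v = w then 2 else 0 := by
    intro v w hv
    simp [switchingMatrix, hv]
  have hcol : ∀ v w, v ∉ switchingNodes → switchingMatrix w v = if w = v then 2 else 0 := by
    intro v w hv
    simp only [switchingMatrix, Matrix.of_apply, hv, and_false, if_false, zero_add]
    split_ifs with h1 h2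
    · exact (hv (h1 ▸ h2)).elim
    · rfl
    · rfl
  refine Matrix.pow_apply_self_eq_of_conj (Q := (2 : ℝ)⁻¹ • switchingMatrix.map f) switchingNodes
    nodeRotation ?_ ?_ ?_ ?_ ?_ ?_ ?_ m v
  · rw [Matrix.smul_mul, Matrix.mul_smul, smul_smul, ← Matrix.map_mul, switchingMatrix_mul_self]
    ext u v
    simp [f, Matrix.one_apply, Matrix.ofNat_apply]
    split_ifs <;> norm_num
  · have h := congrArg (fun M : Matrix (Fin 12) (Fin 12) ℤ => M.map f) adjMatrix_mul_switchingMatrix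
    simp only [Matrix.map_mul, f, SimpleGraph.adjMatrix_map_intCast] at h
    simp only [Matrix.smul_mul, Matrix.mul_smul, f, h]
    rw [smul_comm]
  · intro v hv w
    rw [Matrix.smul_apply, Matrix.map_apply, hrow v w hv]
    split_ifs <;> simp [f]
  · intro v hv w
    rw [Matrix.smul_apply, Matrix.map_apply, hcol v w hv]
    split_ifs <;> simp [f]
  · intro u v
    simp [SimpleGraph.adjMatrix_apply, hrotP]
  · intro u v
    simp [SimpleGraph.adjMatrix_apply, hrotS]
  · have : ∀ u ∈ switchingNodes, ∀ v ∈ switchingNodes, ∃ k : Fin 4, (nodeRotation ^ (k : ℕ)) u = v := by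
      decide
    intro u hu v hv
    obtain ⟨k, hk⟩ := this u hu v hv
    exact ⟨k, hk⟩

theorem theorem2 :
    -- one pair of graphs, which serves for all walk lengths and all transformers
    (∃ (G : SimpleGraph (Fin 12)) (S : Finset (Fin 12)),
      IsSwitchingSet G S ∧ G.Connected ∧ (gmSwitch G S).Connected ∧
      IsPlanar G ∧ ¬ IsPlanar (gmSwitch G S) ∧
      (∀ (m : ℕ) (v : Fin 12), (rwMatrix G ^ m) v v = (rwMatrix (gmSwitch G S) ^ m) v v) ∧
      ∀ t : ℕ → ℕ, rwTokens (t 12) G = rwTokens (t 12) (gmSwitch G S) ∧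
        ∀ T : Transformer 12 (t 12),
          T.eval (rwTokens (t 12) G) = T.eval (rwTokens (t 12) (gmSwitch G S))) ∧
    -- no family of transformers decides planarity, however its outputs are decoded
    ∀ (t : ℕ → ℕ) (T : ∀ n : ℕ, Transformer n (t n))
      (accept : ∀ n : ℕ, Set (Fin (T n).outDim → ℝ)),
      ¬ ∀ n : ℕ, 1 ≤ n → ∀ G : SimpleGraph (Fin n), (∀ v, ∃ w, G.Adj v w) →
        ((T n).eval (rwTokens (t n) G) ∈ accept n ↔ IsPlanar G) := by
  have htokens : ∀ k, rwTokens k planarGraph = rwTokens k switchedGraph := by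
    intro k
    ext v i
    exact rwMatrix_pow_apply_self _ v
  refine ⟨⟨planarGraph, switchingNodes, ?_⟩, fun t T accept H => ?_⟩
  · rw [gmSwitch_planarGraph]
    exact ⟨isSwitchingSet_switchingNodes, planarGraph_connected, switchedGraph_connected,
      isPlanar_planarGraph, not_isPlanar_switchedGraph, rwMatrix_pow_apply_self,
      fun t => ⟨htokens _, fun T => by rw [htokens]⟩⟩
  · have h1 := H 12 (by norm_num) planarGraph (by decide)
    have h2 := H 12 (by norm_num) switchedGraph (by decide)
    -- Both instances now test the same output for membership in `accept 12`.
    rw [htokens] at h1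
    exact not_isPlanar_switchedGraph (h2.1 (h1.2 isPlanar_planarGraph))
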